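/- Let $Z$ be a standard $\mathbb R^d$-valued Brownian motion relative to a filtration $(\mathcal F_t)_{t\ge 0}$ on a probability space. Let $E=(E_t(\omega))$ be a (random, time-dependent) field of $k$-dimensional subspaces of $\mathbb R^d$, and let $u_1,\dots,u_k$ and $v_1,\dots,v_k$ be two families of predictable $\mathbb R^d$-valued processes each of which, almost surely for almost every $t$, is an orthonormal basis of $E_t$. Let $U^j=\int u_j u_j^{tr}\,dZ$ and $V^j=\int v_j v_j^{tr}\,dZ$ be (any versions of) the $\mathbb R^d$-valued Itô integrals, and let $A$ and $B$ be the $d\times k$ matrix processes with columns $u_1,\dots,u_k$ and $v_1,\dots,v_k$. Then: 1. almost surely, for almost every $t$, $AA^{tr}$ and $BB^{tr}$ are both the matrix of the orthogonal projection of $\mathbb R^d$ onto $E_t$; 2. $U^1+\dots+U^k=\int AA^{tr}\,dZ$ and $V^1+\dots+V^k=\int BB^{tr}\,dZ$; 3. the processes $\sqrt k\,S^1=U^1+\dots+U^k$ and $\sqrt k\,T^1=V^1+\dots+V^k$ are indistinguishable: almost surely they agree for all $t\ge 0$; 4. for every $n$ and every predictable $n\times d$ matrix process $J$, the transforms $J\star(\sqrt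 k\,S^1)=\int J AA^{tr}\,dZ$ and $J\star(\sqrt k\,T^1)=\int J BB^{tr}\,dZ$ are indistinguishable whenever these integrals are defined. -/

import Mathlib

open MeasureTheory ProbabilityTheory Filter Topology
open scoped NNReal ENNReal

namespace BasisChoice

variable {Ω : Type*} {mΩ : MeasurableSpace Ω}

/-- `Z` is a standard `d`-dimensional Brownian motion relative to the filtration `𝓕`: it is adapted,
starts at `0`, has continuous paths, and each increment `Z t - Z s` is independent of `𝓕 s` with
law `N(0, (t - s) I_d)`. -/
structure IsBrownianMotion {d : ℕ} (𝓕 : Filtration ℝ≥0 mΩ) (P : Measure Ω)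
    (Z : ℝ≥0 → Ω → Fin d → ℝ) : Prop where
  adapted : ∀ t, Measurable[𝓕 t] (Z t)
  start : ∀ᵐ ω ∂P, Z 0 ω = 0
  continuous_paths : ∀ᵐ ω ∂P, Continuous fun t => Z t ω
  law_increment : ∀ s t, s ≤ t →
    HasLaw (fun ω => Z t ω - Z s ω) (Measure.pi fun _ => gaussianReal 0 (t - s)) P
  indep_increment : ∀ s t, s ≤ t →
    Indep (𝓕 s) (MeasurableSpace.comap (fun ω => Z t ω - Z s ω) inferInstance) P

/-- A simple predictable `n × d` matrix integrand `∑ i, ξ_i 1_{(a_i, b_i]}`, where each `ξ_i` is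
bounded and `𝓕 (a_i)`-measurable. -/
structure SimpleIntegrand (𝓕 : Filtration ℝ≥0 mΩ) (n d : ℕ) where
  /-- the number of intervals -/
  size : ℕ
  /-- left end points -/
  left : Fin size → ℝ≥0
  /-- right end points -/
  right : Fin size → ℝ≥0
  /-- the coefficient on each interval -/
  coeff : Fin size → Ω → Matrix (Fin n) (Fin d) ℝ
  left_le_right : ∀ i, left i ≤ right i
  measurable_coeff : ∀ i a b, Measurable[𝓕 (left i)] fun ω => coeff i ω a b
  bounded_coeff : ∃ C : ℝ, ∀ i ω a b, |coeff i ω a b| ≤ C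

namespace SimpleIntegrand

variable {𝓕 : Filtration ℝ≥0 mΩ} {n d : ℕ}

/-- The matrix process `∑ i, ξ_i 1_{(a_i, b_i]}(t)`. -/
noncomputable def value (φ : SimpleIntegrand 𝓕 n d) (t : ℝ≥0) (ω : Ω) :
    Matrix (Fin n) (Fin d) ℝ :=
  ∑ i, (Set.Ioc (φ.left i) (φ.right i)).indicator (fun _ => φ.coeff i ω) t

/-- The elementary integral `∑ i, ξ_i (Z_{t ∧ b_i} - Z_{t ∧ a_i})`. -/
noncomputable def integral (φ : SimpleIntegrand 𝓕 n d) (Z : ℝ≥0 → Ω → Fin d → ℝ) (t : ℝ≥0)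
    (ω : Ω) : Fin n → ℝ :=
  ∑ i, (φ.coeff i ω).mulVec (Z (min t (φ.right i)) ω - Z (min t (φ.left i)) ω)

end SimpleIntegrand

/-- Lebesgue measure on the time axis `[0, ∞)`. -/
noncomputable def timeMeasure : Measure ℝ≥0 :=
  ((volume : Measure ℝ).restrict (Set.Ici 0)).map Real.toNNReal

/-- The energy `∫_0^T |H_s|² ds` of a matrix process, with the Hilbert–Schmidt norm. -/
noncomputable def energy {n d : ℕ} (H : ℝ≥0 → Ω → Matrix (Fin n) (Fin d) ℝ) (T : ℝ≥0) (ω : Ω) :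
    ℝ≥0∞ :=
  ∫⁻ s in Set.Iic T, ENNReal.ofReal (∑ a, ∑ b, H s ω a b ^ 2) ∂timeMeasure

/-- `X` is (a version of) the Itô integral `∫ H · dZ`. Here `H` is a predictable `n × d` matrix
process with `∫_0^T |H_s|² ds < ∞` a.s. for all `T`, and `X` has continuous paths and is the limit,
uniformly on compact time intervals in probability, of the elementary integrals of simple
integrands `φ m` such that `∫_0^T |φ m - H|² ds → 0` in probability for all `T`. This determines `X`
up to indistinguishability. -/
structure IsItoIntegral {n d : ℕ} (𝓕 : Filtration ℝ≥0 mΩ) (P : Measure Ω)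
    (Z : ℝ≥0 → Ω → Fin d → ℝ) (H : ℝ≥0 → Ω → Matrix (Fin n) (Fin d) ℝ)
    (X : ℝ≥0 → Ω → Fin n → ℝ) : Prop where
  predictable : ∀ a b, IsStronglyPredictable 𝓕 fun t ω => H t ω a b
  energy_lt_top : ∀ᵐ ω ∂P, ∀ T, energy H T ω < ∞
  continuous_paths : ∀ᵐ ω ∂P, Continuous fun t => X t ω
  approx : ∃ φ : ℕ → SimpleIntegrand 𝓕 n d, ∀ T : ℝ≥0, ∀ ε : ℝ, 0 < ε →
    Tendsto (fun m => P {ω | ENNReal.ofReal ε ≤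
      energy (fun s ω => (φ m).value s ω - H s ω) T ω}) atTop (𝓝 0) ∧
    Tendsto (fun m => P {ω | ∃ t ≤ T, ε ≤ ‖(φ m).integral Z t ω - X t ω‖}) atTop (𝓝 0)

/-- Two processes are indistinguishable: almost surely, their paths agree at all times. -/
def Indistinguishable {n : ℕ} (P : Measure Ω) (X Y : ℝ≥0 → Ω → Fin n → ℝ) : Prop :=
  ∀ᵐ ω ∂P, ∀ t, X t ω = Y t ω

/-- The processes `u 1, …, u k` in `ℝ^d` are predictable and, almost surely and for almost every
time `t`, they form an orthonormal basis of the subspace `E t ω`. -/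
structure IsBasisField {k d : ℕ} (𝓕 : Filtration ℝ≥0 mΩ) (P : Measure Ω)
    (E : ℝ≥0 → Ω → Submodule ℝ (EuclideanSpace ℝ (Fin d)))
    (u : Fin k → ℝ≥0 → Ω → EuclideanSpace ℝ (Fin d)) : Prop where
  predictable : ∀ j, IsStronglyPredictable 𝓕 (u j)
  orthonormal_span : ∀ᵐ ω ∂P, ∀ᵐ t ∂timeMeasure,
    Orthonormal ℝ (fun j => u j t ω) ∧
      Submodule.span ℝ (Set.range fun j => u j t ω) = E t ω

/-- The `d × d` matrix `u u^tr`. -/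
def outer {d : ℕ} (u : ℝ≥0 → Ω → EuclideanSpace ℝ (Fin d)) (t : ℝ≥0) (ω : Ω) :
    Matrix (Fin d) (Fin d) ℝ :=
  Matrix.vecMulVec (u t ω) (u t ω)

/-- The `d × k` matrix with columns `u 1, …, u k`. -/
def frame {k d : ℕ} (u : Fin k → ℝ≥0 → Ω → EuclideanSpace ℝ (Fin d)) (t : ℝ≥0) (ω : Ω) :
    Matrix (Fin d) (Fin k) ℝ :=
  Matrix.of fun a j => u j t ω a

/-- The matrix `A A^tr` with `A` the matrix with columns `u 1, …, u k`. -/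
def frameProj {k d : ℕ} (u : Fin k → ℝ≥0 → Ω → EuclideanSpace ℝ (Fin d)) (t : ℝ≥0) (ω : Ω) :
    Matrix (Fin d) (Fin d) ℝ :=
  frame u t ω * (frame u t ω).transpose

end BasisChoice

/-! Any orthonormal basis of $E_t$ gives the same projection, $\sum_j u_j u_j^{tr} = AA^{tr}$, so
$AA^{tr} = BB^{tr}$ for almost every time, almost surely (`frameProj_mulVec_eq_starProjection`). The
sums of the $U^j$ and of the $V^j$ are the integrals of these matrices by linearity. What remains,
also after multiplication by $J$, is uniqueness: integrands that agree almost everywhere have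
indistinguishable integrals (`IsItoIntegral.indistinguishable`).

Itô integrals are specified here only by approximation in probability, with no moment assumption, so
uniqueness rests on a Lenglart-type bound for simple integrands, $P(|\int\varphi\,dZ| \ge
\varepsilon) \le \delta/\varepsilon^2 + P(\text{energy} \ge \delta)$
(`measure_le_norm_integral_le`). It comes from cutting a discrete integrand off before its energy
passes $\delta$, then applying the Itô isometry and Chebyshev's inequality. For a difference of
integrals with null integrand, the approximating energies tend to $0$ in probability, so the limit
vanishes at each fixed time; path continuity extends this to all times at once. -/

namespace BasisChoice

variable {Ω : Type*} {mΩ : MeasurableSpace Ω}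

/-! ### Moments of Brownian increments and the discrete Itô isometry. -/

namespace IsBrownianMotion

variable {d : ℕ} {𝓕 : Filtration ℝ≥0 mΩ} {P : Measure Ω} {Z : ℝ≥0 → Ω → Fin d → ℝ} {s t : ℝ≥0}

lemma hasLaw_increment_apply (hZ : IsBrownianMotion 𝓕 P Z) (hst : s ≤ t) (b : Fin d) :
    HasLaw (fun ω => Z t ω b - Z s ω b) (gaussianReal 0 (t - s)) P := by
  have h : HasLaw (fun x : Fin d → ℝ => x b) (gaussianReal 0 (t - s))
      (Measure.pi fun _ => gaussianReal 0 (t - s)) :=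
    ⟨(measurable_pi_apply b).aemeasurable,
      (measurePreserving_eval (fun _ : Fin d => gaussianReal 0 (t - s)) b).map_eq⟩
  exact h.comp (hZ.law_increment s t hst)

lemma memLp_increment (hZ : IsBrownianMotion 𝓕 P Z) (hst : s ≤ t) (b : Fin d) :
    MemLp (fun ω => Z t ω b - Z s ω b) 2 P := by
  have h := hZ.hasLaw_increment_apply hst b
  have h2 : MemLp id 2 (P.map fun ω => Z t ω b - Z s ω b) := by
    rw [h.map_eq]; exact memLp_id_gaussianReal 2
  exact h2.comp_of_map h.aemeasurable

lemma integral_increment (hZ : IsBrownianMotion 𝓕 P Z) (hst : s ≤ t) (b : Fin d) :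
    ∫ ω, (Z t ω b - Z s ω b) ∂P = 0 := by
  rw [(hZ.hasLaw_increment_apply hst b).integral_eq, integral_id_gaussianReal]

lemma integral_increment_mul (hZ : IsBrownianMotion 𝓕 P Z) (hst : s ≤ t) (b c : Fin d) :
    ∫ ω, (Z t ω b - Z s ω b) * (Z t ω c - Z s ω c) ∂P = if b = c then (t : ℝ) - s else 0 := by
  split_ifs with hbc
  · subst hbc
    have h := (hZ.hasLaw_increment_apply hst b).variance_eq
    have h0 := hZ.integral_increment hst b
    have hm := (hZ.hasLaw_increment_apply hst b).aemeasurable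
    rw [variance_id_gaussianReal, variance_of_integral_eq_zero hm h0] at h
    rw [← NNReal.coe_sub hst, ← h]
    simp [pow_two]
  · have hlaw := hZ.law_increment s t hst
    have hind : IndepFun (fun x : Fin d → ℝ => x b) (fun x : Fin d → ℝ => x c)
        (Measure.pi fun _ : Fin d => gaussianReal 0 (t - s)) :=
      (iIndepFun_pi (μ := fun _ : Fin d => gaussianReal 0 (t - s)) (X := fun _ => id)
        (fun _ => aemeasurable_id)).indepFun hbc
    have h1 := hlaw.integral_comp (f := fun x : Fin d → ℝ => x b * x c) (by fun_prop)
    have h2 := hlaw.integral_comp (f := fun x : Fin d → ℝ => x b)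
      (measurable_pi_apply b).aestronglyMeasurable
    have h3 := hZ.integral_increment hst b
    simp only [Function.comp_def, Pi.sub_apply] at h1 h2
    rw [h1, hind.integral_fun_mul_eq_mul_integral
      (measurable_pi_apply b).aestronglyMeasurable (measurable_pi_apply c).aestronglyMeasurable,
      ← h2, h3, zero_mul]

lemma indepFun_increment (hZ : IsBrownianMotion 𝓕 P Z) (hst : s ≤ t) {X : Ω → ℝ}
    (hX : Measurable[𝓕 s] X) {f : (Fin d → ℝ) → ℝ} (hf : Measurable f) :
    IndepFun X (fun ω => f (Z t ω - Z s ω)) P := by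
  rw [IndepFun_iff_Indep]
  refine indep_of_indep_of_le_left (indep_of_indep_of_le_right (hZ.indep_increment s t hst) ?_)
    hX.comap_le
  exact (hf.comp (comap_measurable fun ω => Z t ω - Z s ω)).comap_le

lemma integrable_mul_increment (hZ : IsBrownianMotion 𝓕 P Z) [IsFiniteMeasure P] (hst : s ≤ t)
    {X : Ω → ℝ} (hX : Measurable[𝓕 s] X) (hXi : Integrable X P) (b : Fin d) :
    Integrable (fun ω => X ω * (Z t ω b - Z s ω b)) P :=
  (hZ.indepFun_increment hst hX (f := fun x => x b) (by fun_prop)).integrable_mul hXi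
    ((hZ.memLp_increment hst b).integrable (by norm_num))

lemma integral_mul_increment (hZ : IsBrownianMotion 𝓕 P Z) (hst : s ≤ t)
    {X : Ω → ℝ} (hX : Measurable[𝓕 s] X) (b : Fin d) :
    ∫ ω, X ω * (Z t ω b - Z s ω b) ∂P = 0 := by
  have h := (hZ.indepFun_increment hst hX (f := fun x => x b)
    (by fun_prop)).integral_fun_mul_eq_mul_integral
      (hX.mono (𝓕.le s) le_rfl).aestronglyMeasurable
      (hZ.hasLaw_increment_apply hst b).aemeasurable.aestronglyMeasurable
  simp only [Pi.sub_apply, hZ.integral_increment hst b, mul_zero] at h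
  exact h

lemma integrable_mul_increment_mul (hZ : IsBrownianMotion 𝓕 P Z) (hst : s ≤ t)
    {X : Ω → ℝ} (hX : Measurable[𝓕 s] X) (hXi : Integrable X P) (b c : Fin d) :
    Integrable (fun ω => X ω * ((Z t ω b - Z s ω b) * (Z t ω c - Z s ω c))) P :=
  (hZ.indepFun_increment hst hX (f := fun x => x b * x c) (by fun_prop)).integrable_mul hXi
    ((hZ.memLp_increment hst b).integrable_mul (hZ.memLp_increment hst c))

lemma integral_mul_increment_mul (hZ : IsBrownianMotion 𝓕 P Z) (hst : s ≤ t)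
    {X : Ω → ℝ} (hX : Measurable[𝓕 s] X) (b c : Fin d) :
    ∫ ω, X ω * ((Z t ω b - Z s ω b) * (Z t ω c - Z s ω c)) ∂P =
      if b = c then (∫ ω, X ω ∂P) * ((t : ℝ) - s) else 0 := by
  have h := (hZ.indepFun_increment hst hX (f := fun x => x b * x c)
    (by fun_prop)).integral_fun_mul_eq_mul_integral
      (hX.mono (𝓕.le s) le_rfl).aestronglyMeasurable
      ((hZ.hasLaw_increment_apply hst b).aemeasurable.mul
        (hZ.hasLaw_increment_apply hst c).aemeasurable).aestronglyMeasurable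
  simp only [Pi.sub_apply, hZ.integral_increment_mul hst] at h
  rw [h]; split_ifs <;> simp

/-- The discrete stochastic integral of a bounded adapted sequence of row vectors is square
integrable and satisfies the Itô isometry. -/
lemma discrete_isometry (hZ : IsBrownianMotion 𝓕 P Z) [IsFiniteMeasure P] {s : ℕ → ℝ≥0}
    (hs : Monotone s) {c : ℕ → Ω → Fin d → ℝ} (hc : ∀ i b, Measurable[𝓕 (s i)] fun ω => c i ω b)
    {C : ℝ} (hC : ∀ i ω b, |c i ω b| ≤ C) (N : ℕ) :
    (Measurable[𝓕 (s N)] fun ω =>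
      ∑ i ∈ Finset.range N, ∑ b, c i ω b * (Z (s (i + 1)) ω b - Z (s i) ω b)) ∧
    MemLp (fun ω => ∑ i ∈ Finset.range N, ∑ b, c i ω b * (Z (s (i + 1)) ω b - Z (s i) ω b)) 2 P ∧
    ∫ ω, (∑ i ∈ Finset.range N, ∑ b, c i ω b * (Z (s (i + 1)) ω b - Z (s i) ω b)) ^ 2 ∂P =
      ∫ ω, ∑ i ∈ Finset.range N, (∑ b, c i ω b ^ 2) * ((s (i + 1) : ℝ) - s i) ∂P := by
  have hc' : ∀ i b, Measurable fun ω => c i ω b := fun i b => (hc i b).mono (𝓕.le _) le_rfl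
  have hcT : ∀ i b, MemLp (fun ω => c i ω b) ⊤ P := fun i b =>
    memLp_top_of_bound (hc' i b).aestronglyMeasurable C (ae_of_all _ fun ω => hC i ω b)
  have hcc : ∀ i b b', Integrable (fun ω => c i ω b * c i ω b') P := fun i b b' =>
    ((hcT i b).mono_exponent le_top : MemLp _ 2 P).integrable_mul
      ((hcT i b').mono_exponent le_top : MemLp _ 2 P)
  have hD : ∀ i, MemLp (fun ω => ∑ b, c i ω b * (Z (s (i + 1)) ω b - Z (s i) ω b)) 2 P := by
    intro i
    refine memLp_finsetSum _ fun b _ => ?_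
    exact (hZ.memLp_increment (hs (Nat.le_succ i)) b).mul (hcT i b)
  -- Measurability at time `s N` is carried through the induction because it makes the past sum
  -- times the next coefficient independent of the next increment.
  induction N with
  | zero => simp [measurable_const]
  | succ N ih =>
    obtain ⟨ihm, ihL, ihI⟩ := ih
    have hst := hs (Nat.le_succ N)
    simp only [Finset.sum_range_succ]
    set M := fun ω => ∑ i ∈ Finset.range N, ∑ b, c i ω b * (Z (s (i + 1)) ω b - Z (s i) ω b)
    change ∫ ω, M ω ^ 2 ∂P = _ at ihI
    refine ⟨?_, ihL.add (hD N), ?_⟩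
    · refine (ihm.mono (𝓕.mono hst) le_rfl).add ?_
      refine Finset.measurable_sum _ fun b _ => ((hc N b).mono (𝓕.mono hst) le_rfl).mul ?_
      exact ((measurable_pi_apply b).comp (hZ.adapted _)).sub
        (((measurable_pi_apply b).comp (hZ.adapted _)).mono (𝓕.mono hst) le_rfl)
    · have hMc : ∀ b, Integrable (fun ω => M ω * c N ω b) P := fun b =>
        ihL.integrable_mul ((hcT N b).mono_exponent le_top : MemLp _ 2 P)
      have hMcm : ∀ b, Measurable[𝓕 (s N)] (fun ω => M ω * c N ω b) := fun b => ihm.mul (hc N b)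
      -- Past squared, cross term, new square. The cross term has mean zero by independence, and in
      -- the new square only the diagonal `b = b'` survives.
      have hexp : ∀ ω, (M ω + ∑ b, c N ω b * (Z (s (N + 1)) ω b - Z (s N) ω b)) ^ 2 =
          M ω ^ 2 + (2 * ∑ b, (M ω * c N ω b) * (Z (s (N + 1)) ω b - Z (s N) ω b) +
          ∑ b, ∑ b', (c N ω b * c N ω b') * ((Z (s (N + 1)) ω b - Z (s N) ω b) *
            (Z (s (N + 1)) ω b' - Z (s N) ω b'))) := by
        intro ω
        have e1 : ∑ b, (M ω * c N ω b) * (Z (s (N + 1)) ω b - Z (s N) ω b) =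
            M ω * ∑ b, c N ω b * (Z (s (N + 1)) ω b - Z (s N) ω b) := by
          rw [Finset.mul_sum]; exact Finset.sum_congr rfl fun _ _ => by ring
        have e2 : ∑ b, ∑ b', (c N ω b * c N ω b') * ((Z (s (N + 1)) ω b - Z (s N) ω b) *
            (Z (s (N + 1)) ω b' - Z (s N) ω b')) =
            (∑ b, c N ω b * (Z (s (N + 1)) ω b - Z (s N) ω b)) ^ 2 := by
          rw [pow_two, Finset.sum_mul_sum]
          exact Finset.sum_congr rfl fun _ _ => Finset.sum_congr rfl fun _ _ => by ring
        rw [e1, e2]; ring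
      have i1 : ∀ b, Integrable
          (fun ω => (M ω * c N ω b) * (Z (s (N + 1)) ω b - Z (s N) ω b)) P :=
        fun b => hZ.integrable_mul_increment hst (hMcm b) (hMc b) b
      have hccm : ∀ b b', Measurable[𝓕 (s N)] (fun ω => c N ω b * c N ω b') :=
        fun b b' => (hc N b).mul (hc N b')
      have i2 : ∀ b b', Integrable (fun ω => (c N ω b * c N ω b') *
          ((Z (s (N + 1)) ω b - Z (s N) ω b) * (Z (s (N + 1)) ω b' - Z (s N) ω b'))) P :=
        fun b b' => hZ.integrable_mul_increment_mul hst (hccm b b') (hcc N b b') b b'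
      have i3 : ∀ i, Integrable (fun ω => (∑ b, c i ω b ^ 2) * ((s (i + 1) : ℝ) - s i)) P := by
        intro i
        refine (integrable_finsetSum _ fun b _ => ?_).mul_const _
        simpa [pow_two] using hcc i b b
      refine (integral_congr_ae (ae_of_all _ hexp)).trans ?_
      have j1 : Integrable (fun ω =>
          2 * ∑ b, (M ω * c N ω b) * (Z (s (N + 1)) ω b - Z (s N) ω b)) P :=
        (integrable_finsetSum _ fun b _ => i1 b).const_mul 2
      have j2 : ∀ b, Integrable (fun ω => ∑ b', (c N ω b * c N ω b') *
          ((Z (s (N + 1)) ω b - Z (s N) ω b) * (Z (s (N + 1)) ω b' - Z (s N) ω b'))) P :=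
        fun b => integrable_finsetSum _ fun b' _ => i2 b b'
      have j3 := integrable_finsetSum Finset.univ fun b _ => j2 b
      have j4 : ∀ b, Integrable (fun ω => c N ω b ^ 2) P := fun b => by
        simpa [pow_two] using hcc N b b
      rw [integral_add ihL.integrable_sq (j1.fun_add j3), integral_add j1 j3,
        integral_const_mul, integral_finsetSum _ fun b _ => i1 b,
        integral_finsetSum _ fun b _ => j2 b,
        integral_add (integrable_finsetSum _ fun i _ => i3 i) (i3 N), ihI, integral_mul_const,
        integral_finsetSum _ fun b _ => j4 b]
      simp_rw [integral_finsetSum Finset.univ fun b' _ => i2 _ b',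
        fun b => hZ.integral_mul_increment hst (hMcm b) b,
        fun b b' => hZ.integral_mul_increment_mul hst (hccm b b') b b']
      simp [Finset.sum_mul, pow_two]

end IsBrownianMotion

/-! ### Truncation by energy and the discrete tail bound. -/

/-- By monotonicity the retained increments form an initial block, so they telescope to a value of
`A` that is at most `δ`. Testing `A (i + 1)` rather than `A i` prevents overshooting. -/
lemma sum_truncated_increments_le {A : ℕ → ℝ} (hA : Monotone A) (h0 : A 0 = 0) {δ : ℝ}
    (hδ : 0 ≤ δ) (N : ℕ) :
    ∑ i ∈ Finset.range N, (if A (i + 1) ≤ δ then A (i + 1) - A i else 0) ≤ min (A N) δ := by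
  induction N with
  | zero => simp [h0, hδ]
  | succ N ih =>
    have := hA (Nat.le_succ N)
    rw [Finset.sum_range_succ]
    split_ifs with h
    · rw [min_eq_left h]
      linarith [ih.trans (min_le_left _ _)]
    · rw [add_zero]
      exact ih.trans (min_le_min_right _ this)

/-- Tail bound for discrete stochastic integrals in terms of the tail of their energy. -/
lemma IsBrownianMotion.discrete_tail_bound {n d : ℕ} {𝓕 : Filtration ℝ≥0 mΩ} {P : Measure Ω}
    [IsFiniteMeasure P] {Z : ℝ≥0 → Ω → Fin d → ℝ} (hZ : IsBrownianMotion 𝓕 P Z) {s : ℕ → ℝ≥0}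
    (hs : Monotone s) {c : ℕ → Ω → Matrix (Fin n) (Fin d) ℝ}
    (hc : ∀ i a b, Measurable[𝓕 (s i)] fun ω => c i ω a b)
    {C : ℝ} (hC : ∀ i ω a b, |c i ω a b| ≤ C) (N : ℕ) {ε δ : ℝ} (hε : 0 < ε) (hδ : 0 ≤ δ) :
    P {ω | ε ≤ ‖∑ i ∈ Finset.range N, (c i ω).mulVec (Z (s (i + 1)) ω - Z (s i) ω)‖} ≤
      ENNReal.ofReal (δ * P.real Set.univ / ε ^ 2) +
      P {ω | δ < ∑ i ∈ Finset.range N,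
        (∑ a, ∑ b, c i ω a b ^ 2) * ((s (i + 1) : ℝ) - s i)} := by
  classical
  set A : ℕ → Ω → ℝ := fun m ω => ∑ i ∈ Finset.range m,
    (∑ a, ∑ b, c i ω a b ^ 2) * ((s (i + 1) : ℝ) - s i) with hA
  have hA0 : ∀ ω, A 0 ω = 0 := fun ω => by simp [hA]
  have hAs : ∀ i ω, A (i + 1) ω - A i ω =
      (∑ a, ∑ b, c i ω a b ^ 2) * ((s (i + 1) : ℝ) - s i) := fun i ω => by
    simp [hA, Finset.sum_range_succ]
  have hAmono : ∀ ω, Monotone fun m => A m ω := fun ω => monotone_nat_of_le_succ fun i => by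
    rw [← sub_nonneg, hAs]
    have : (s i : ℝ) ≤ s (i + 1) := by exact_mod_cast hs (Nat.le_succ i)
    exact mul_nonneg (by positivity) (sub_nonneg.2 this)
  -- The energy up to step `i + 1` involves only the coefficients `c 0, …, c i` and deterministic
  -- lengths, so it is already known at time `s i`.
  have hAm : ∀ i, Measurable[𝓕 (s i)] (A (i + 1)) := fun i => by
    refine Finset.measurable_sum _ fun j hj => Measurable.mul_const ?_ _
    refine Finset.measurable_sum _ fun a _ => Finset.measurable_sum _ fun b _ => ?_
    exact ((hc j a b).mono (𝓕.mono (hs (Nat.lt_succ_iff.1 (Finset.mem_range.1 hj)))) le_rfl).pow_const 2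
  -- The integrand is switched off just before its energy would exceed `δ`. By `hAm` the cut-off is
  -- still adapted, so the isometry applies with total energy at most `δ`.
  set c' : ℕ → Ω → Matrix (Fin n) (Fin d) ℝ := fun i ω => if A (i + 1) ω ≤ δ then c i ω else 0
    with hc'
  have hc'm : ∀ a i b, Measurable[𝓕 (s i)] fun ω => c' i ω a b := fun a i b => by
    have : (fun ω => c' i ω a b) = fun ω => if A (i + 1) ω ≤ δ then c i ω a b else 0 := by
      ext ω; simp only [hc']; split_ifs <;> rfl
    rw [this]
    exact Measurable.ite (measurableSet_le (hAm i) measurable_const) (hc i a b) measurable_const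
  have hc'C : ∀ a i ω b, |c' i ω a b| ≤ C := fun a i ω b => by
    simp only [hc']
    split_ifs
    · exact hC i ω a b
    · simpa using (abs_nonneg _).trans (hC i ω a b)
  have hiso := fun a => hZ.discrete_isometry hs (c := fun i ω b => c' i ω a b) (hc'm a) (hc'C a) N
  set M : Fin n → Ω → ℝ := fun a ω =>
    ∑ i ∈ Finset.range N, ∑ b, c' i ω a b * (Z (s (i + 1)) ω b - Z (s i) ω b) with hM
  have hMapply : ∀ ω a, (∑ i ∈ Finset.range N, (c' i ω).mulVec (Z (s (i + 1)) ω - Z (s i) ω)) a =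
      M a ω := fun ω a => by
    simp [hM, Finset.sum_apply, Matrix.mulVec, dotProduct]
  have hsq : ∀ a, Integrable (fun ω => M a ω ^ 2) P := fun a => (hiso a).2.1.integrable_sq
  have hi : ∀ a, Integrable (fun ω => ∑ i ∈ Finset.range N,
      (∑ b, c' i ω a b ^ 2) * ((s (i + 1) : ℝ) - s i)) P := fun a => by
    refine integrable_finsetSum _ fun i _ => (integrable_finsetSum _ fun b _ => ?_).mul_const _
    refine Integrable.of_bound
      (((hc'm a i b).mono (𝓕.le _) le_rfl).pow_const 2).aestronglyMeasurable (C ^ 2)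
      (ae_of_all _ fun ω => ?_)
    rw [Real.norm_eq_abs, abs_pow]
    exact pow_le_pow_left₀ (abs_nonneg _) (hc'C a i ω b) 2
  have hbound : ∫ ω, ∑ a, M a ω ^ 2 ∂P ≤ δ * P.real Set.univ := by
    rw [integral_finsetSum _ fun a _ => hsq a, Finset.sum_congr rfl fun a _ => (hiso a).2.2,
      ← integral_finsetSum _ fun a _ => hi a]
    have : ∫ _, δ ∂P = δ * P.real Set.univ := by simp [mul_comm]
    rw [← this]
    refine integral_mono (integrable_finsetSum _ fun a _ => hi a) (integrable_const _) fun ω => ?_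
    refine le_trans (le_of_eq ?_)
      ((sum_truncated_increments_le (hAmono ω) (hA0 ω) hδ N).trans (min_le_right _ _))
    simp only
    rw [Finset.sum_comm]
    refine Finset.sum_congr rfl fun i _ => ?_
    rw [← Finset.sum_mul]
    simp only [hc', hAs]
    split_ifs <;> simp
  have hmarkov : P {ω | ε ^ 2 ≤ ∑ a, M a ω ^ 2} ≤ ENNReal.ofReal (δ * P.real Set.univ / ε ^ 2) := by
    have h := mul_meas_ge_le_integral_of_nonneg (μ := P) (f := fun ω => ∑ a, M a ω ^ 2)
      (ae_of_all _ fun ω => by positivity) (integrable_finsetSum _ fun a _ => hsq a) (ε ^ 2)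
    rw [← ENNReal.ofReal_toReal (measure_ne_top P {ω | ε ^ 2 ≤ ∑ a, M a ω ^ 2})]
    refine ENNReal.ofReal_le_ofReal ?_
    rw [le_div_iff₀ (by positivity), mul_comm]
    exact h.trans hbound
  -- Either the energy exceeds `δ`, or the truncation changed nothing and Chebyshev's inequality
  -- applies.
  refine (measure_mono fun ω hω => ?_).trans ((measure_union_le _ _).trans (add_le_add_left hmarkov _))
  by_cases hω' : δ < A N ω
  · exact Or.inr hω'
  · left
    push Not at hω'
    have heq : ∑ i ∈ Finset.range N, (c i ω).mulVec (Z (s (i + 1)) ω - Z (s i) ω) =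
        ∑ i ∈ Finset.range N, (c' i ω).mulVec (Z (s (i + 1)) ω - Z (s i) ω) := by
      refine Finset.sum_congr rfl fun i hi => ?_
      have : A (i + 1) ω ≤ δ := (hAmono ω (Finset.mem_range.1 hi)).trans hω'
      simp [hc', this]
    rw [Set.mem_ofPred_eq, heq] at hω
    by_contra hcon
    rw [Set.mem_ofPred_eq, not_le] at hcon
    -- The norm on `Fin n → ℝ` is the sup norm, so each coordinate is bounded separately by the
    -- Euclidean sum of squares.
    refine absurd hω (not_le.2 ((pi_norm_lt_iff hε).2 fun a => ?_))
    rw [hMapply, Real.norm_eq_abs]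
    refine abs_lt_of_sq_lt_sq (lt_of_le_of_lt ?_ hcon) hε.le
    exact Finset.single_le_sum (f := fun a => M a ω ^ 2) (fun _ _ => sq_nonneg _)
      (Finset.mem_univ a)

/-! ### Elementary integrals as sums along partitions. -/

lemma timeMeasure_Ioc (a b : ℝ≥0) :
    timeMeasure (Set.Ioc a b) = ENNReal.ofReal ((b : ℝ) - a) := by
  rw [timeMeasure, Measure.map_apply measurable_real_toNNReal measurableSet_Ioc,
    Measure.restrict_apply (measurable_real_toNNReal measurableSet_Ioc)]
  have : Real.toNNReal ⁻¹' Set.Ioc a b ∩ Set.Ici 0 = Set.Ioc (a : ℝ) b := by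
    ext x
    simp only [Set.mem_inter_iff, Set.mem_preimage, Set.mem_Ioc, Set.mem_Ici,
      Real.lt_toNNReal_iff_coe_lt, Real.toNNReal_le_iff_le_coe]
    exact ⟨fun h => h.1, fun h => ⟨h, a.2.trans h.1.le⟩⟩
  rw [this, Real.volume_Ioc]

/-- Any finite set of times is contained in the set of nodes of some partition of `[0, t]`, up to
times past `t`. -/
lemma exists_partition (S : Finset ℝ≥0) (t : ℝ≥0) :
    ∃ (N : ℕ) (s : ℕ → ℝ≥0), Monotone s ∧ s 0 = 0 ∧ s N = t ∧
      ∀ x ∈ S, ∀ i, x ≤ s i ∨ s (i + 1) ≤ x := by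
  classical
  set R : Finset ℝ≥0 := (insert 0 (insert t S)).filter (· ≤ t) with hR
  have h0 : (0 : ℝ≥0) ∈ R := by simp [hR]
  have ht : t ∈ R := by simp [hR]
  have hle : ∀ x ∈ R, x ≤ t := fun x hx => (Finset.mem_filter.1 hx).2
  obtain ⟨N, hN⟩ : ∃ N, R.card = N + 1 :=
    Nat.exists_eq_succ_of_ne_zero (Finset.card_ne_zero_of_mem h0)
  let e := R.orderEmbOfFin hN
  have he : ∀ x ∈ R, ∃ j, e j = x := fun x hx => by
    have := R.range_orderEmbOfFin hN
    have hx' : x ∈ Set.range e := by rw [this]; exact hx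
    exact hx'
  have hmem : ∀ j, e j ∈ R := R.orderEmbOfFin_mem hN
  -- The sequence is frozen at its last node `t` from index `N` on, so monotonicity and the
  -- separation property hold for every `i`.
  refine ⟨N, fun i => e ⟨min i N, by omega⟩, ?_, ?_, ?_, ?_⟩
  · intro i j hij
    refine e.monotone ?_
    simp only [Fin.mk_le_mk]; omega
  · obtain ⟨j, hj⟩ := he 0 h0
    refine le_antisymm ?_ zero_le
    rw [← hj]
    refine e.monotone (Fin.mk_le_of_le_val ?_)
    simp
  · obtain ⟨j, hj⟩ := he t ht
    refine le_antisymm (hle _ (hmem _)) ?_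
    rw [← hj]
    refine e.monotone (Fin.le_def.2 ?_)
    simp only [min_self]; omega
  · intro x hx i
    by_cases hxt : x ≤ t
    · obtain ⟨j, hj⟩ := he x (by simp [hR, hx, hxt])
      rw [← hj]
      rcases Nat.lt_or_ge i j with h | h
      · exact Or.inr (e.monotone (Fin.le_def.2 (by simp only; omega)))
      · exact Or.inl (e.monotone (Fin.le_def.2 (by simp only; omega)))
    · exact Or.inr ((hle _ (hmem _)).trans (not_le.1 hxt).le)

/-- Neither `l` nor `r` lies strictly between `a` and `b`, so a nondegenerate cell `(a, b]` is
inside `(l, r]` or disjoint from it. This matches the increment of an elementary integral over a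
cell with value times increment. -/
lemma ite_mem_Ioc_sub_eq {G : Type*} [AddCommGroup G] (z : ℝ≥0 → G) {l r a b : ℝ≥0} (hlr : l ≤ r)
    (hab : a ≤ b) (hl : l ≤ a ∨ b ≤ l) (hr : r ≤ a ∨ b ≤ r) :
    (if b ∈ Set.Ioc l r then z b - z a else 0) =
      (z (min b r) - z (min b l)) - (z (min a r) - z (min a l)) := by
  rcases hl with hl | hl
  · rcases hr with hr | hr
    · rw [min_eq_right hr, min_eq_right hl, min_eq_right (hr.trans hab),
        min_eq_right (hl.trans hab), sub_self]
      split_ifs with h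
      · rw [le_antisymm hab (h.2.trans hr), sub_self]
      · rfl
    · rw [min_eq_left hr, min_eq_right hl, min_eq_left (hab.trans hr), min_eq_right (hl.trans hab)]
      split_ifs with h
      · abel
      · rw [Set.mem_Ioc, not_and_or, not_lt, not_le] at h
        rcases h with h | h
        · rw [le_antisymm hab (h.trans hl)]; abel
        · exact absurd hr (not_le.2 h)
  · rw [min_eq_left hl, min_eq_left (hab.trans hl), min_eq_left (hl.trans hlr),
      min_eq_left (hab.trans (hl.trans hlr)), if_neg fun h => absurd h.1 (not_lt.2 hl)]
    abel

namespace SimpleIntegrand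

variable {𝓕 : Filtration ℝ≥0 mΩ} {n d : ℕ}

/-- The partition `s` is subordinate to the jump times of `φ`. -/
def IsSubordinate (φ : SimpleIntegrand 𝓕 n d) (s : ℕ → ℝ≥0) : Prop :=
  ∀ j i, (φ.left j ≤ s i ∨ s (i + 1) ≤ φ.left j) ∧ (φ.right j ≤ s i ∨ s (i + 1) ≤ φ.right j)

lemma exists_isSubordinate (φ : SimpleIntegrand 𝓕 n d) (t : ℝ≥0) :
    ∃ (N : ℕ) (s : ℕ → ℝ≥0), Monotone s ∧ s 0 = 0 ∧ s N = t ∧ φ.IsSubordinate s := by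
  classical
  obtain ⟨N, s, hs, h0, hN, h⟩ :=
    exists_partition (Finset.univ.image φ.left ∪ Finset.univ.image φ.right) t
  exact ⟨N, s, hs, h0, hN, fun j i => ⟨h _ (by simp) i, h _ (by simp) i⟩⟩

lemma value_eq_of_mem (φ : SimpleIntegrand 𝓕 n d) {s : ℕ → ℝ≥0} (h : φ.IsSubordinate s) {i : ℕ}
    {x : ℝ≥0} (hx : x ∈ Set.Ioc (s i) (s (i + 1))) (ω : Ω) :
    φ.value x ω = φ.value (s (i + 1)) ω := by
  classical
  unfold value
  refine Finset.sum_congr rfl fun j _ => ?_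
  have : x ∈ Set.Ioc (φ.left j) (φ.right j) ↔ s (i + 1) ∈ Set.Ioc (φ.left j) (φ.right j) := by
    obtain ⟨h1, h2⟩ := h j i
    obtain ⟨hx1, hx2⟩ := hx
    refine and_congr ⟨fun hl => hl.trans_le hx2, fun hl => ?_⟩
      ⟨fun hr => ?_, fun hr => hx2.trans hr⟩
    · exact (h1.resolve_right (not_le.2 hl)).trans_lt hx1
    · exact h2.resolve_left (not_le.2 (hx1.trans_le hr))
  simp only [Set.indicator_apply, this]

/-- An interval containing `s (i + 1)` starts strictly before it, hence by subordination no later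
than `s i`, where its coefficient is known. This is where left-open intervals matter. -/
lemma measurable_value (φ : SimpleIntegrand 𝓕 n d) {s : ℕ → ℝ≥0} (h : φ.IsSubordinate s) (i : ℕ)
    (a : Fin n) (b : Fin d) : Measurable[𝓕 (s i)] fun ω => φ.value (s (i + 1)) ω a b := by
  classical
  simp only [value, Matrix.sum_apply, Set.indicator_apply]
  refine Finset.measurable_sum _ fun j _ => ?_
  split_ifs with hj
  · exact (φ.measurable_coeff j a b).mono
      (𝓕.mono ((h j i).1.resolve_right (not_le.2 hj.1))) le_rfl
  · exact measurable_const

lemma exists_abs_value_le (φ : SimpleIntegrand 𝓕 n d) :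
    ∃ C : ℝ, ∀ t ω a b, |φ.value t ω a b| ≤ C := by
  classical
  obtain ⟨C, hC⟩ := φ.bounded_coeff
  refine ⟨∑ _ : Fin φ.size, |C|, fun t ω a b => ?_⟩
  simp only [value, Matrix.sum_apply, Set.indicator_apply]
  refine (Finset.abs_sum_le_sum_abs _ _).trans (Finset.sum_le_sum fun j _ => ?_)
  split_ifs
  · exact (hC j ω a b).trans (le_abs_self C)
  · simp

/-- Each summand is the increment of the elementary integral over a cell, so the sum telescopes; the
integral vanishes at `s 0 = 0`. -/
lemma integral_eq_sum (φ : SimpleIntegrand 𝓕 n d) {s : ℕ → ℝ≥0} (hs : Monotone s) (h0 : s 0 = 0)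
    (h : φ.IsSubordinate s) (Z : ℝ≥0 → Ω → Fin d → ℝ) (N : ℕ) (ω : Ω) :
    φ.integral Z (s N) ω =
      ∑ i ∈ Finset.range N, (φ.value (s (i + 1)) ω).mulVec (Z (s (i + 1)) ω - Z (s i) ω) := by
  classical
  have key : ∀ i, (φ.value (s (i + 1)) ω).mulVec (Z (s (i + 1)) ω - Z (s i) ω) =
      φ.integral Z (s (i + 1)) ω - φ.integral Z (s i) ω := fun i => by
    unfold value integral
    rw [Matrix.sum_mulVec, ← Finset.sum_sub_distrib]
    refine Finset.sum_congr rfl fun j _ => ?_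
    rw [← Matrix.mulVec_sub, ← ite_mem_Ioc_sub_eq (fun t => Z t ω) (φ.left_le_right j)
      (hs (Nat.le_succ i)) (h j i).1 (h j i).2, Set.indicator_apply]
    split_ifs <;> simp
  have hz : φ.integral Z (s 0) ω = 0 := by simp [integral, h0]
  rw [Finset.sum_congr rfl fun i _ => key i, Finset.sum_range_sub fun i => φ.integral Z (s i) ω,
    hz, sub_zero]

/-- On each cell the value is constant, so the cell contributes exactly its term. The tail bound
needs only this direction, which requires no condition on `s 0`. -/
lemma ofReal_sum_le_energy (φ : SimpleIntegrand 𝓕 n d) {s : ℕ → ℝ≥0} (hs : Monotone s)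
    (h : φ.IsSubordinate s) (N : ℕ) (ω : Ω) :
    ENNReal.ofReal (∑ i ∈ Finset.range N,
      (∑ a, ∑ b, φ.value (s (i + 1)) ω a b ^ 2) * ((s (i + 1) : ℝ) - s i)) ≤
      energy φ.value (s N) ω := by
  induction N with
  | zero => simp
  | succ N ih =>
    rw [Finset.sum_range_succ]
    refine ENNReal.ofReal_add_le.trans ?_
    have hst := hs (Nat.le_succ N)
    have hd : Disjoint (Set.Iic (s N)) (Set.Ioc (s N) (s (N + 1))) :=
      Set.disjoint_left.2 fun x hx hx' => absurd hx'.1 (not_lt.2 hx)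
    rw [energy, ← Set.Iic_union_Ioc_eq_Iic hst, lintegral_union measurableSet_Ioc hd]
    refine add_le_add ih (le_of_eq ?_)
    rw [setLIntegral_congr_fun (g := fun _ =>
        ENNReal.ofReal (∑ a, ∑ b, φ.value (s (N + 1)) ω a b ^ 2)) measurableSet_Ioc
      fun x hx => by simp only [φ.value_eq_of_mem h hx], setLIntegral_const, timeMeasure_Ioc,
      ENNReal.ofReal_mul (by positivity)]

/-- Tail bound for elementary integrals in terms of the tail of their energy. -/
lemma measure_le_norm_integral_le (φ : SimpleIntegrand 𝓕 n d) {P : Measure Ω}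
    [IsProbabilityMeasure P] {Z : ℝ≥0 → Ω → Fin d → ℝ} (hZ : IsBrownianMotion 𝓕 P Z) (t : ℝ≥0)
    {ε δ : ℝ} (hε : 0 < ε) (hδ : 0 ≤ δ) :
    P {ω | ε ≤ ‖φ.integral Z t ω‖} ≤
      ENNReal.ofReal (δ / ε ^ 2) + P {ω | ENNReal.ofReal δ ≤ energy φ.value t ω} := by
  obtain ⟨N, s, hs, h0, rfl, h⟩ := φ.exists_isSubordinate t
  obtain ⟨C, hC⟩ := φ.exists_abs_value_le
  have key := hZ.discrete_tail_bound hs (c := fun i ω => φ.value (s (i + 1)) ω)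
    (fun i a b => φ.measurable_value h i a b) (fun i ω a b => hC _ ω a b) N hε hδ
  simp only [φ.integral_eq_sum hs h0 h]
  refine key.trans (add_le_add (by simp) (measure_mono fun ω hω => ?_))
  exact (ENNReal.ofReal_le_ofReal (le_of_lt hω)).trans (φ.ofReal_sum_le_energy hs h N ω)

end SimpleIntegrand

/-! ### Algebra of simple integrands. -/

namespace SimpleIntegrand

variable {𝓕 : Filtration ℝ≥0 mΩ} {n d : ℕ}

/-- The zero simple integrand. -/
def zero (𝓕 : Filtration ℝ≥0 mΩ) (n d : ℕ) : SimpleIntegrand 𝓕 n d where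
  size := 0
  left := Fin.elim0
  right := Fin.elim0
  coeff := Fin.elim0
  left_le_right := fun i => i.elim0
  measurable_coeff := fun i => i.elim0
  bounded_coeff := ⟨0, fun i => i.elim0⟩

@[simp]
lemma value_zero (t : ℝ≥0) (ω : Ω) : (zero 𝓕 n d).value t ω = 0 := by
  unfold value; exact Finset.sum_of_isEmpty (ι := Fin 0) _

@[simp]
lemma integral_zero (Z : ℝ≥0 → Ω → Fin d → ℝ) (t : ℝ≥0) (ω : Ω) :
    (zero 𝓕 n d).integral Z t ω = 0 := by
  unfold integral; exact Finset.sum_of_isEmpty (ι := Fin 0) _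

/-- The sum of two simple integrands. -/
def add (φ ψ : SimpleIntegrand 𝓕 n d) : SimpleIntegrand 𝓕 n d where
  size := φ.size + ψ.size
  left := Fin.append φ.left ψ.left
  right := Fin.append φ.right ψ.right
  coeff := Fin.append φ.coeff ψ.coeff
  left_le_right := Fin.addCases (fun i => by simpa using φ.left_le_right i)
    fun i => by simpa using ψ.left_le_right i
  measurable_coeff := Fin.addCases
    (fun i a b => by
      rw [Fin.append_left, Fin.append_left]
      exact φ.measurable_coeff i a b)
    fun i a b => by
      rw [Fin.append_right, Fin.append_right]
      exact ψ.measurable_coeff i a b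
  bounded_coeff := by
    obtain ⟨C, hC⟩ := φ.bounded_coeff
    obtain ⟨D, hD⟩ := ψ.bounded_coeff
    refine ⟨max C D, Fin.addCases (fun i ω a b => ?_) fun i ω a b => ?_⟩
    · simpa using Or.inl (hC i ω a b)
    · simpa using Or.inr (hD i ω a b)

@[simp]
lemma value_add (φ ψ : SimpleIntegrand 𝓕 n d) (t : ℝ≥0) (ω : Ω) :
    (φ.add ψ).value t ω = φ.value t ω + ψ.value t ω := by
  refine (Fin.sum_univ_add (a := φ.size) (b := ψ.size) _).trans ?_
  simp [value, add]

@[simp]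
lemma integral_add (φ ψ : SimpleIntegrand 𝓕 n d) (Z : ℝ≥0 → Ω → Fin d → ℝ) (t : ℝ≥0) (ω : Ω) :
    (φ.add ψ).integral Z t ω = φ.integral Z t ω + ψ.integral Z t ω := by
  refine (Fin.sum_univ_add (a := φ.size) (b := ψ.size) _).trans ?_
  simp [integral, add]

/-- The negative of a simple integrand. -/
def neg (φ : SimpleIntegrand 𝓕 n d) : SimpleIntegrand 𝓕 n d where
  size := φ.size
  left := φ.left
  right := φ.right
  coeff := fun i ω => -φ.coeff i ω
  left_le_right := φ.left_le_right
  measurable_coeff := fun i a b => (φ.measurable_coeff i a b).neg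
  bounded_coeff := by simpa using φ.bounded_coeff

@[simp]
lemma value_neg (φ : SimpleIntegrand 𝓕 n d) (t : ℝ≥0) (ω : Ω) :
    φ.neg.value t ω = -φ.value t ω := by
  classical
  simp only [value, neg, ← Finset.sum_neg_distrib, Set.indicator_apply]
  refine Finset.sum_congr rfl fun i _ => ?_
  split_ifs <;> simp

@[simp]
lemma integral_neg (φ : SimpleIntegrand 𝓕 n d) (Z : ℝ≥0 → Ω → Fin d → ℝ) (t : ℝ≥0) (ω : Ω) :
    φ.neg.integral Z t ω = -φ.integral Z t ω := by
  simp only [integral, neg, ← Finset.sum_neg_distrib, Matrix.neg_mulVec]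
  rfl

lemma measurable_value_time (φ : SimpleIntegrand 𝓕 n d) (ω : Ω) (a : Fin n) (b : Fin d) :
    Measurable fun t => φ.value t ω a b := by
  classical
  simp only [value, Matrix.sum_apply, Set.indicator_apply]
  refine Finset.measurable_sum _ fun j _ => ?_
  have : (fun t => (if t ∈ Set.Ioc (φ.left j) (φ.right j) then φ.coeff j ω else 0) a b) =
      fun t => if t ∈ Set.Ioc (φ.left j) (φ.right j) then φ.coeff j ω a b else 0 := by
    ext t; split_ifs <;> rfl
  rw [this]
  exact Measurable.ite measurableSet_Ioc measurable_const measurable_const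

end SimpleIntegrand

/-! ### Measurability in time and energy estimates. -/

lemma predictable_le_prod (𝓕 : Filtration ℝ≥0 mΩ) :
    𝓕.predictable ≤ (inferInstance : MeasurableSpace (ℝ≥0 × Ω)) :=
  measurableSpace_le_predictable_of_measurableSet
    (fun A hA => (measurableSet_singleton _).prod (𝓕.le _ A hA))
    fun _ A hA => measurableSet_Ioi.prod (𝓕.le _ A hA)

/-- Needed to split the energy of a sum path by path: predictable processes are jointly measurable,
and so are measurable along sections. -/
lemma measurable_time_of_isStronglyPredictable {𝓕 : Filtration ℝ≥0 mΩ} {f : ℝ≥0 → Ω → ℝ}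
    (hf : IsStronglyPredictable 𝓕 f) (ω : Ω) : Measurable fun t => f t ω :=
  ((StronglyMeasurable.mono hf (predictable_le_prod 𝓕)).measurable).comp
    (measurable_id.prodMk measurable_const)

section Energy

variable {n d : ℕ} {H K : ℝ≥0 → Ω → Matrix (Fin n) (Fin d) ℝ}

lemma energy_neg (T : ℝ≥0) (ω : Ω) : energy (fun s ω => -H s ω) T ω = energy H T ω := by
  simp [energy]

lemma energy_congr {ω : Ω} (h : ∀ᵐ t ∂timeMeasure, H t ω = K t ω) (T : ℝ≥0) :
    energy H T ω = energy K T ω :=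
  lintegral_congr_ae (ae_restrict_of_ae (h.mono fun t ht => by simp only [ht]))

/-- Entrywise $(x+y)^2 \le 2x^2 + 2y^2$. -/
lemma energy_add_le {ω : Ω} (hH : ∀ a b, Measurable fun t => H t ω a b) (T : ℝ≥0) :
    energy (fun s ω => H s ω + K s ω) T ω ≤ 2 * energy H T ω + 2 * energy K T ω := by
  have hm : Measurable fun s => ENNReal.ofReal (∑ a, ∑ b, H s ω a b ^ 2) :=
    (Finset.measurable_sum _ fun a _ => Finset.measurable_sum _ fun b _ =>
      (hH a b).pow_const 2).ennreal_ofReal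
  unfold energy
  rw [← mul_add, ← lintegral_add_left hm, ← lintegral_const_mul' _ _ (by norm_num)]
  refine lintegral_mono fun s => ?_
  rw [← ENNReal.ofReal_add (by positivity) (by positivity)]
  have h2 : (2 : ℝ≥0∞) = ENNReal.ofReal 2 := by simp
  rw [h2, ← ENNReal.ofReal_mul (by norm_num)]
  refine ENNReal.ofReal_le_ofReal ?_
  simp only [← Finset.sum_add_distrib, Finset.mul_sum]
  refine Finset.sum_le_sum fun a _ => Finset.sum_le_sum fun b _ => ?_
  rw [Matrix.add_apply]
  nlinarith [sq_nonneg (H s ω a b - K s ω a b)]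

/-- Combined with `energy_add_le`, this covers the event of a large energy for a sum by the two
events for its summands, as convergence in probability requires. -/
lemma ofReal_le_or_of_le_two_mul_add {x y z : ℝ≥0∞} {ε : ℝ} (hε : 0 < ε)
    (hz : ENNReal.ofReal ε ≤ z) (h : z ≤ 2 * x + 2 * y) :
    ENNReal.ofReal (ε / 4) ≤ x ∨ ENNReal.ofReal (ε / 4) ≤ y := by
  by_contra! hcon
  have h1 : x + y < ENNReal.ofReal (ε / 2) := by
    have := ENNReal.add_lt_add hcon.1 hcon.2
    rwa [← ENNReal.ofReal_add (by positivity) (by positivity),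
      show ε / 4 + ε / 4 = ε / 2 by ring] at this
  have h2 : 2 * (x + y) < ENNReal.ofReal ε := by
    have h3 := ENNReal.mul_lt_mul_right (a := 2) (by norm_num) (by norm_num) h1
    rwa [show (2 : ℝ≥0∞) * ENNReal.ofReal (ε / 2) = ENNReal.ofReal ε by
      rw [show (2 : ℝ≥0∞) = ENNReal.ofReal 2 by simp, ← ENNReal.ofReal_mul (by norm_num)]
      congr 1; ring] at h3
  rw [mul_add] at h2
  exact absurd (hz.trans h) (not_le.2 h2)

end Energy

/-! ### Linearity and uniqueness of the Itô integral. -/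

namespace IsItoIntegral

variable {n d : ℕ} {𝓕 : Filtration ℝ≥0 mΩ} {P : Measure Ω} {Z : ℝ≥0 → Ω → Fin d → ℝ}
  {H K : ℝ≥0 → Ω → Matrix (Fin n) (Fin d) ℝ} {X Y : ℝ≥0 → Ω → Fin n → ℝ}

protected lemma zero : IsItoIntegral 𝓕 P Z (fun _ _ => (0 : Matrix (Fin n) (Fin d) ℝ))
    (fun _ _ => 0) where
  predictable := fun _ _ => stronglyMeasurable_const
  energy_lt_top := ae_of_all _ fun ω T => by simp [energy]
  continuous_paths := ae_of_all _ fun ω => continuous_const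
  approx := by
    refine ⟨fun _ => SimpleIntegrand.zero 𝓕 n d, fun T ε hε => ?_⟩
    have h1 : ¬ε ≤ 0 := not_le.2 hε
    simp [energy, h1]

protected lemma add (hX : IsItoIntegral 𝓕 P Z H X) (hY : IsItoIntegral 𝓕 P Z K Y) :
    IsItoIntegral 𝓕 P Z (fun t ω => H t ω + K t ω) (fun t ω => X t ω + Y t ω) where
  predictable := fun a b => (hX.predictable a b).add (hY.predictable a b)
  energy_lt_top := by
    filter_upwards [hX.energy_lt_top, hY.energy_lt_top] with ω h1 h2 T
    refine (energy_add_le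
      (fun a b => measurable_time_of_isStronglyPredictable (hX.predictable a b) ω) T).trans_lt ?_
    exact ENNReal.add_lt_top.2 ⟨ENNReal.mul_lt_top (by norm_num) (h1 T),
      ENNReal.mul_lt_top (by norm_num) (h2 T)⟩
  continuous_paths := by
    filter_upwards [hX.continuous_paths, hY.continuous_paths] with ω h1 h2 using h1.add h2
  approx := by
    obtain ⟨φ, hφ⟩ := hX.approx
    obtain ⟨ψ, hψ⟩ := hY.approx
    refine ⟨fun m => (φ m).add (ψ m), fun T ε hε => ⟨?_, ?_⟩⟩
    · have hlim := ((hφ T (ε / 4) (by positivity)).1).add ((hψ T (ε / 4) (by positivity)).1)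
      rw [add_zero] at hlim
      refine tendsto_of_tendsto_of_tendsto_of_le_of_le tendsto_const_nhds hlim
        (fun _ => zero_le) fun m => (measure_mono fun ω hω => ?_).trans (measure_union_le _ _)
      refine ofReal_le_or_of_le_two_mul_add hε hω ?_
      refine le_trans (le_of_eq ?_) (energy_add_le (H := fun s ω => (φ m).value s ω - H s ω)
        (K := fun s ω => (ψ m).value s ω - K s ω) (fun a b => ?_) T)
      · congr 1; ext s ω a b
        simp only [SimpleIntegrand.value_add, Matrix.sub_apply, Matrix.add_apply]; ring
      · exact ((φ m).measurable_value_time ω a b).sub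
          (measurable_time_of_isStronglyPredictable (hX.predictable a b) ω)
    · have hlim := ((hφ T (ε / 2) (by positivity)).2).add ((hψ T (ε / 2) (by positivity)).2)
      rw [add_zero] at hlim
      refine tendsto_of_tendsto_of_tendsto_of_le_of_le tendsto_const_nhds hlim
        (fun _ => zero_le) fun m => (measure_mono ?_).trans (measure_union_le _ _)
      rintro ω ⟨t, ht, hω⟩
      by_contra hcon
      rw [Set.mem_union, not_or] at hcon
      have h1 : ‖(φ m).integral Z t ω - X t ω‖ < ε / 2 :=
        not_le.1 fun h => hcon.1 ⟨t, ht, h⟩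
      have h2 : ‖(ψ m).integral Z t ω - Y t ω‖ < ε / 2 :=
        not_le.1 fun h => hcon.2 ⟨t, ht, h⟩
      rw [SimpleIntegrand.integral_add, add_sub_add_comm] at hω
      linarith [norm_add_le ((φ m).integral Z t ω - X t ω) ((ψ m).integral Z t ω - Y t ω)]

protected lemma neg (hX : IsItoIntegral 𝓕 P Z H X) :
    IsItoIntegral 𝓕 P Z (fun t ω => -H t ω) (fun t ω => -X t ω) where
  predictable := fun a b => (hX.predictable a b).neg
  energy_lt_top := by simpa only [energy_neg] using hX.energy_lt_top
  continuous_paths := hX.continuous_paths.mono fun ω h => h.neg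
  approx := by
    obtain ⟨φ, hφ⟩ := hX.approx
    refine ⟨fun m => (φ m).neg, fun T ε hε => ⟨?_, ?_⟩⟩
    · have h : ∀ m ω, energy (fun s ω => (φ m).neg.value s ω - -H s ω) T ω =
          energy (fun s ω => (φ m).value s ω - H s ω) T ω := fun m ω => by
        rw [← energy_neg]; congr 1; ext s ω a b; simp; ring
      simpa only [h] using (hφ T ε hε).1
    · have h : ∀ m t ω, ‖(φ m).neg.integral Z t ω - -X t ω‖ =
          ‖(φ m).integral Z t ω - X t ω‖ := fun m t ω => by
        rw [← norm_neg, SimpleIntegrand.integral_neg]; congr 1; abel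
      simpa only [h] using (hφ T ε hε).2

protected lemma sum {ι : Type*} {H : ι → ℝ≥0 → Ω → Matrix (Fin n) (Fin d) ℝ}
    {X : ι → ℝ≥0 → Ω → Fin n → ℝ} (hX : ∀ j, IsItoIntegral 𝓕 P Z (H j) (X j)) (s : Finset ι) :
    IsItoIntegral 𝓕 P Z (fun t ω => ∑ j ∈ s, H j t ω) (fun t ω => ∑ j ∈ s, X j t ω) := by
  classical
  induction s using Finset.induction_on with
  | empty => simpa using IsItoIntegral.zero
  | insert j s hj ih => simpa only [Finset.sum_insert hj] using (hX j).add ih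

/-- The integral of an integrand that vanishes almost everywhere vanishes at each time. -/
lemma ae_eq_zero [IsProbabilityMeasure P] (hZ : IsBrownianMotion 𝓕 P Z)
    (hX : IsItoIntegral 𝓕 P Z H X) (hH : ∀ᵐ ω ∂P, ∀ᵐ t ∂timeMeasure, H t ω = 0) (t : ℝ≥0) :
    ∀ᵐ ω ∂P, X t ω = 0 := by
  obtain ⟨φ, hφ⟩ := hX.approx
  have hzero : ∀ ε : ℝ, 0 < ε → P {ω | 2 * ε ≤ ‖X t ω‖} = 0 := by
    intro ε hε
    refine le_antisymm (ENNReal.le_of_forall_pos_le_add fun η hη _ => ?_) zero_le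
    -- The energy level `η * ε ^ 2` makes the Chebyshev term equal to `η`; the other two
    -- probabilities tend to `0` with `m`.
    have hδ : (0 : ℝ) < η * ε ^ 2 := by positivity
    have hlim := ((hφ t (η * ε ^ 2) hδ).1.const_add (η : ℝ≥0∞)).add (hφ t ε hε).2
    rw [add_zero, add_zero] at hlim
    rw [zero_add]
    refine ge_of_tendsto' hlim fun m => ?_
    have henergy : P {ω | ENNReal.ofReal (η * ε ^ 2) ≤ energy (φ m).value t ω} =
        P {ω | ENNReal.ofReal (η * ε ^ 2) ≤ energy (fun s ω => (φ m).value s ω - H s ω) t ω} := by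
      refine measure_congr ?_
      filter_upwards [hH] with ω hω
      have : energy (φ m).value t ω = energy (fun s ω => (φ m).value s ω - H s ω) t ω :=
        energy_congr (hω.mono fun s hs => by simp only [hs, sub_zero]) t
      simp only [Set.ofPred, this]
    have htail := (φ m).measure_le_norm_integral_le hZ t hε hδ.le
    rw [henergy, mul_div_assoc, div_self (by positivity), mul_one, ENNReal.ofReal_coe_nnreal]
      at htail
    refine le_trans ((measure_mono ?_).trans (measure_union_le _ _)) (add_le_add_left htail _)
    intro ω hω
    by_contra hcon
    rw [Set.mem_union, not_or] at hcon
    have h1 : ‖(φ m).integral Z t ω‖ < ε := not_le.1 hcon.1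
    have h2 : ‖(φ m).integral Z t ω - X t ω‖ < ε := not_le.1 fun h => hcon.2 ⟨t, le_rfl, h⟩
    have h3 : 2 * ε ≤ ‖X t ω‖ := hω
    have h4 := norm_sub_le ((φ m).integral Z t ω) ((φ m).integral Z t ω - X t ω)
    rw [sub_sub_cancel] at h4
    linarith
  have hall : ∀ᵐ ω ∂P, ∀ k : ℕ, ¬2 * (1 / ((k : ℝ) + 1)) ≤ ‖X t ω‖ :=
    ae_all_iff.2 fun k => by
      rw [ae_iff]
      simpa only [not_not] using hzero (1 / ((k : ℝ) + 1)) (by positivity)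
  filter_upwards [hall] with ω hω
  by_contra hne
  obtain ⟨k, hk⟩ := exists_nat_one_div_lt (half_pos (norm_pos_iff.2 hne))
  exact hω k (by linarith)

/-- Itô integrals of almost everywhere equal integrands are indistinguishable. -/
lemma indistinguishable [IsProbabilityMeasure P] (hZ : IsBrownianMotion 𝓕 P Z)
    (hX : IsItoIntegral 𝓕 P Z H X) (hY : IsItoIntegral 𝓕 P Z K Y)
    (hHK : ∀ᵐ ω ∂P, ∀ᵐ t ∂timeMeasure, H t ω = K t ω) : Indistinguishable P X Y := by
  have hD := hX.add hY.neg
  have h0 := hD.ae_eq_zero hZ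
    (hHK.mono fun ω hω => hω.mono fun t ht => by rw [ht, add_neg_cancel])
  -- A countable dense set of times permits a single null set; continuity of paths then gives
  -- equality at all times.
  obtain ⟨S, hSc, hSd⟩ := TopologicalSpace.exists_countable_dense ℝ≥0
  have hS : ∀ᵐ ω ∂P, ∀ t ∈ S, X t ω + -Y t ω = 0 := (ae_ball_iff hSc).2 fun t _ => h0 t
  filter_upwards [hS, hX.continuous_paths, hY.continuous_paths] with ω h1 h2 h3 t
  exact congrFun (Continuous.ext_on hSd h2 h3 fun t ht => add_neg_eq_zero.1 (h1 t ht)) t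

end IsItoIntegral

/-! ### Orthogonal projection onto the span of a frame. -/

section Frame

variable {k d : ℕ}

/-- Column-by-row expansion of the product; it links the sum of the integrals to the integral of
$AA^{tr}$. -/
lemma frameProj_eq_sum_outer (u : Fin k → ℝ≥0 → Ω → EuclideanSpace ℝ (Fin d)) (t : ℝ≥0) (ω : Ω) :
    frameProj u t ω = ∑ j, outer (u j) t ω := by
  ext a b
  simp [frameProj, frame, outer, Matrix.mul_apply, Matrix.sum_apply, Matrix.vecMulVec_apply]

/-- The vector $\sum_j \langle u_j, x\rangle u_j$ lies in the span, and its difference from `x` is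
orthogonal to each $u_j$, hence to the span; these two properties characterise the projection. -/
lemma frameProj_mulVec_eq_starProjection {u : Fin k → ℝ≥0 → Ω → EuclideanSpace ℝ (Fin d)}
    {t : ℝ≥0} {ω : Ω} {F : Submodule ℝ (EuclideanSpace ℝ (Fin d))}
    (ho : Orthonormal ℝ fun j => u j t ω)
    (hspan : Submodule.span ℝ (Set.range fun j => u j t ω) = F) (x : EuclideanSpace ℝ (Fin d)) :
    (frameProj u t ω).mulVec x = F.starProjection x := by
  have hproj : F.starProjection x = ∑ j, inner ℝ (u j t ω) x • u j t ω := by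
    refine Submodule.eq_starProjection_of_mem_of_inner_eq_zero ?_ fun w hw => ?_
    · rw [← hspan]
      exact Submodule.sum_mem _ fun j _ =>
        Submodule.smul_mem _ _ (Submodule.subset_span (Set.mem_range_self j))
    · rw [← hspan] at hw
      induction hw using Submodule.span_induction with
      | mem w hw =>
        obtain ⟨j, rfl⟩ := hw
        rw [real_inner_comm, inner_sub_right, ho.inner_right_fintype, sub_self]
      | zero => simp
      | add w w' _ _ h h' => rw [inner_add_right, h, h', add_zero]
      | smul c w _ h => rw [inner_smul_right, h, mul_zero]
  rw [hproj, frameProj_eq_sum_outer]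
  ext a
  simp only [Matrix.sum_mulVec, outer, Matrix.vecMulVec_mulVec, Finset.sum_apply,
    WithLp.ofLp_sum, WithLp.ofLp_smul, Pi.smul_apply, PiLp.inner_apply, dotProduct]
  refine Finset.sum_congr rfl fun j _ => ?_
  simp [mul_comm]

lemma IsBasisField.frameProj_mulVec {𝓕 : Filtration ℝ≥0 mΩ} {P : Measure Ω}
    {E : ℝ≥0 → Ω → Submodule ℝ (EuclideanSpace ℝ (Fin d))}
    {u : Fin k → ℝ≥0 → Ω → EuclideanSpace ℝ (Fin d)} (hu : IsBasisField 𝓕 P E u) :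
    ∀ᵐ ω ∂P, ∀ᵐ t ∂timeMeasure, ∀ x : EuclideanSpace ℝ (Fin d),
      (frameProj u t ω).mulVec x = (E t ω).starProjection x :=
  hu.orthonormal_span.mono fun _ hω => hω.mono fun _ ht x =>
    frameProj_mulVec_eq_starProjection ht.1 ht.2 x

end Frame

end BasisChoice

open BasisChoice in
/-- Let `Z` be an `ℝ^d`-Brownian motion, and let `u` and `v` be two predictable orthonormal bases of
the same (random, time-dependent) `k`-dimensional subspace `E` of `ℝ^d`. Put `U j = ∫ u_j u_j · dZ`
and `V j = ∫ v_j v_j · dZ`. Then `A A^tr` and `B B^tr` are the orthogonal projection onto `E`,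
`∑ j, U j` and `∑ j, V j` are the integrals of `A A^tr` and `B B^tr`, and they are the same process.
So are the transforms by any predictable matrix process `J`, where the transform by `J` of the
integral `∫ G · dZ` is `∫ J G · dZ`. -/
theorem proposition4p1 {Ω : Type*} {mΩ : MeasurableSpace Ω} (P : Measure Ω) [IsProbabilityMeasure P]
    (𝓕 : Filtration ℝ≥0 mΩ) (k d : ℕ)
    (Z : ℝ≥0 → Ω → Fin d → ℝ) (hZ : IsBrownianMotion 𝓕 P Z)
    (E : ℝ≥0 → Ω → Submodule ℝ (EuclideanSpace ℝ (Fin d)))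
    (u v : Fin k → ℝ≥0 → Ω → EuclideanSpace ℝ (Fin d))
    (hu : IsBasisField 𝓕 P E u) (hv : IsBasisField 𝓕 P E v)
    (U V : Fin k → ℝ≥0 → Ω → Fin d → ℝ)
    (hU : ∀ j, IsItoIntegral 𝓕 P Z (outer (u j)) (U j))
    (hV : ∀ j, IsItoIntegral 𝓕 P Z (outer (v j)) (V j)) :
    (∀ᵐ ω ∂P, ∀ᵐ t ∂timeMeasure, ∀ x : EuclideanSpace ℝ (Fin d),
      (frameProj u t ω).mulVec x = (E t ω).starProjection x ∧
      (frameProj v t ω).mulVec x = (E t ω).starProjection x) ∧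
    IsItoIntegral 𝓕 P Z (frameProj u) (fun t ω => ∑ j, U j t ω) ∧
    IsItoIntegral 𝓕 P Z (frameProj v) (fun t ω => ∑ j, V j t ω) ∧
    Indistinguishable P (fun t ω => ∑ j, U j t ω) (fun t ω => ∑ j, V j t ω) ∧
    (∀ (n : ℕ) (J : ℝ≥0 → Ω → Matrix (Fin n) (Fin d) ℝ),
      (∀ a b, IsStronglyPredictable 𝓕 fun t ω => J t ω a b) →
      ∀ X Y : ℝ≥0 → Ω → Fin n → ℝ,
        IsItoIntegral 𝓕 P Z (fun t ω => J t ω * frameProj u t ω) X →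
        IsItoIntegral 𝓕 P Z (fun t ω => J t ω * frameProj v t ω) Y →
        Indistinguishable P X Y) := by
  have hproj : ∀ᵐ ω ∂P, ∀ᵐ t ∂timeMeasure, ∀ x : EuclideanSpace ℝ (Fin d),
      (frameProj u t ω).mulVec x = (E t ω).starProjection x ∧
      (frameProj v t ω).mulVec x = (E t ω).starProjection x := by
    filter_upwards [hu.frameProj_mulVec, hv.frameProj_mulVec] with ω h1 h2
    filter_upwards [h1, h2] with t h1 h2 x using ⟨h1 x, h2 x⟩
  have heq : ∀ᵐ ω ∂P, ∀ᵐ t ∂timeMeasure, frameProj u t ω = frameProj v t ω :=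
    -- Both matrices act as the projection onto the same `E t ω`; comparing them on the standard
    -- basis vectors gives equality of all columns.
    hproj.mono fun ω hω => hω.mono fun t ht => Matrix.ext_of_mulVec_single fun i => by
      obtain ⟨h1, h2⟩ := ht (WithLp.toLp 2 (Pi.single i 1))
      exact h1.trans h2.symm
  have hsum : ∀ w : Fin k → ℝ≥0 → Ω → EuclideanSpace ℝ (Fin d),
      frameProj w = fun t ω => ∑ j, outer (w j) t ω := fun w => by
    ext1 t; ext1 ω; exact frameProj_eq_sum_outer w t ω
  have hIu : IsItoIntegral 𝓕 P Z (frameProj u) (fun t ω => ∑ j, U j t ω) := by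
    rw [hsum u]; exact IsItoIntegral.sum hU Finset.univ
  have hIv : IsItoIntegral 𝓕 P Z (frameProj v) (fun t ω => ∑ j, V j t ω) := by
    rw [hsum v]; exact IsItoIntegral.sum hV Finset.univ
  refine ⟨hproj, hIu, hIv, hIu.indistinguishable hZ hIv heq, fun n J _ X Y hX hY => ?_⟩
  exact hX.indistinguishable hZ hY
    (heq.mono fun ω hω => hω.mono fun t ht => by rw [ht])
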